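/- **Setting.** Let $\Omega,\Theta,A$ be finite sets (seller signals, buyer signals, buyer actions), $A\ne\emptyset$, and let $B\subset\mathbb R$ be a finite set of possible buyer budgets. Let $\mu$ be a probability distribution on $\Omega\times\Theta\times B$ (arbitrarily correlated), $u:\Omega\times\Theta\times A\to\mathbb R$ the buyer's utility, and $M\ge 0$ the seller's budget. Write $\mu(\theta,b)=\sum_\omega\mu(\omega,\theta,b)$ and $\mu(\omega\mid\theta,b)=\mu(\omega,\theta,b)/\mu(\theta,b)$ (set to $0$ if $\mu(\theta,b)=0$). In the *public budget* setting $B=\{b\}$ and only $\theta$ is reported. In the *private budget* setting a buyer $(\theta,b)$ may report any $(\theta',b')$ with $b'\le b$, because the reported budget has to be deposited. A *consulting mechanism with probabilistic return* (CM-probR) consists of probabilities $p^{+}_{\theta,b}(\omega,a),p^{-}_{\theta,b}(\omega,a)\ge 0$ with $\sum_{a}\big[p^+_{\theta,b}(\omega,a)+p^-_{\theta,b}(\omega,a)\big]=1$ for all $\theta,b,\omega$. After a report and deposit $(\theta',b')$, the signal $[a,\circ]$, $\circ\in\{+,-\}$, is sent with probability $p^\circ_{\theta',b'}(\omega,a)$;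 on $+$ nothing is returned and on $-$ the amount $b'+M$ is returned, so the net payments are $t^+_{b'}=b'$ and $t^-_{b'}=-M$. A CM-probR is required to be *obedient*: for every truthful $(\theta,b)$ with $\mu(\theta,b)>0$ and every signal $[a,\circ]$ of positive probability, $a$ maximizes the buyer's expected utility under his Bayesian posterior. Let $U_{\theta,b}(\theta',b')$ be the expected utility, net of payments, of the buyer $(\theta,b)$ who reports $(\theta',b')$ and then best responds to each signal under his posterior. The mechanism is *IC* if $U_{\theta,b}(\theta,b)\ge U_{\theta,b}(\theta',b')$ for all $(\theta,b)$ with $\mu(\theta,b)>0$ and all reports $(\theta',b')$ available to that buyer; it is *IR* if $U_{\theta,b}(\theta,b)\ge\max_{a'}\sum_\omega\mu(\omega\mid\theta,b)u(\omega,\theta,a')$ for all $(\theta,b)$ with $\mu(\theta,b)>0$. Its revenue is $\sum_{\omega,\theta,b}\mu(\omega,\theta,b)\sum_a\big(b\,p^+_{\theta,b}(\omega,a)-M\,p^-_{\theta,b}(\omega,a)\big)$. An *optimal CM-probR* is one of maximal revenue among the IC and IR CM-probR's. **The linear program.** With variables $p^\pm_{\theta,b}(\omega,a)$ and $z^\pm_{\theta,b,\theta',b',a}$,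 and $V_{\theta,b}(\theta',b')$ as shorthand for $\sum_a\big(z^+_{\theta,b,\theta',b',a}+z^-_{\theta,b,\theta',b',a}\big)$: $$\begin{aligned} \max\ & \sum_{\omega,\theta,b}\mu(\omega,\theta,b)\sum_a\big(b\,p^+_{\theta,b}(\omega,a)-M\,p^-_{\theta,b}(\omega,a)\big)\\ \text{s.t. (IC)}\ & V_{\theta,b}(\theta,b)\ge V_{\theta,b}(\theta',b')\quad\text{for all reports }(\theta',b')\text{ available to }(\theta,b),\\ \text{(IR)}\ & V_{\theta,b}(\theta,b)\ge\sum_\omega\mu(\omega\mid\theta,b)u(\omega,\theta,a')\quad\forall\theta,b,a',\\ \text{(OB)}\ & V_{\theta,b}(\theta,b)\le\sum_{a,\omega,\circ}\mu(\omega\mid\theta,b)\,p^\circ_{\theta,b}(\omega,a)\,(u(\omega,\theta,a)-t^\circ_{b})\quad\forall\theta,b,\\ & z^\circ_{\theta,b,\theta',b',a}\ge\sum_\omega\mu(\omega\mid\theta,b)\,p^\circ_{\theta',b'}(\omega,a)\,(u(\omega,\theta,a')-t^\circ_{b'})\quad\forall\theta,b,\theta',b',a,a',\circ,\\ & \textstyle\sum_a[p^+_{\theta,b}(\omega,a)+p^-_{\theta,b}(\omega,a)]=1,\qquad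 0\le p^\pm_{\theta,b}(\omega,a)\le 1 . \end{aligned}$$ **Theorem.** For correlated signals, with public or private budget, the optimal CM-probR mechanism is computed by this single linear program of polynomial size: 1. With $N=|\Theta||A||\Omega|$ for a public and $N=|\Theta||B||A||\Omega|$ for a private budget, the program has at most $4N^2$ variables and at most $10N^2$ constraints. 2. The $p$-part of every feasible solution is an IC and IR CM-probR whose revenue is the objective value. Conversely, every IC and IR CM-probR, completed by $z^\circ_{\theta,b,\theta',b',a}=\max_{a'}\sum_\omega\mu(\omega\mid\theta,b)p^\circ_{\theta',b'}(\omega,a)(u(\omega,\theta,a')-t^\circ_{b'})$, is a feasible solution whose objective value is its revenue. 3. The program has an optimal solution. The $p$-part of every optimal solution is an optimal CM-probR whose revenue is the optimal value, and every optimal CM-probR, completed as in 2, is an optimal solution. -/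

import Mathlib

/-! ### Linear programs -/

/-- A linear program with variables indexed by `V`, inequality constraints indexed by `C` and
equality constraints indexed by `E`: maximize the scalar product of `objective` and `x` over
`x : V → ℝ`, subject to the constraints that the scalar product of `lhs c` and `x` is at most
`rhs c` for each `c : C`, and that the scalar product of `eqLhs e` and `x` equals `eqRhs e` for
each `e : E`. -/
structure LinearProgram (V C E : Type*) where
  objective : V → ℝ
  lhs : C → V → ℝ
  rhs : C → ℝ
  eqLhs : E → V → ℝ
  eqRhs : E → ℝ

namespace LinearProgram

variable {V C E : Type*} [Fintype V]

/-- The objective value of an assignment. -/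
def value (P : LinearProgram V C E) (x : V → ℝ) : ℝ := P.objective ⬝ᵥ x

/-- `x` satisfies all the constraints. -/
def IsFeasible (P : LinearProgram V C E) (x : V → ℝ) : Prop :=
  (∀ c, P.lhs c ⬝ᵥ x ≤ P.rhs c) ∧ ∀ e, P.eqLhs e ⬝ᵥ x = P.eqRhs e

/-- `x` is an optimal solution. -/
def IsOptimal (P : LinearProgram V C E) (x : V → ℝ) : Prop :=
  P.IsFeasible x ∧ ∀ y, P.IsFeasible y → P.value y ≤ P.value x

/-- The number of variables. -/
def numVariables (_P : LinearProgram V C E) : ℕ := Fintype.card V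

/-- The number of constraints. -/
def numConstraints [Fintype C] [Fintype E] (_P : LinearProgram V C E) : ℕ :=
  Fintype.card C + Fintype.card E

end LinearProgram

/-! ### The model -/

/-- Either the buyer has one fixed, publicly known budget `b`, or his budget is private and
belongs to the finite set `B`. -/
inductive BudgetSetting where
  | publicBudget (b : ℝ)
  | privateBudget (B : Finset ℝ)

namespace BudgetSetting

/-- The finite set of possible budgets. -/
def budgets : BudgetSetting → Finset ℝ
  | publicBudget b => {b}
  | privateBudget B => B

/-- The type of possible budgets. -/
abbrev Budget (S : BudgetSetting) : Type := {b : ℝ // b ∈ S.budgets}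

/-- Whether a buyer with budget `b` is able to report `b'`. A public budget cannot be
misreported. With a private budget he has to deposit what he reports, so `b' ≤ b`. -/
def CanReport : BudgetSetting → ℝ → ℝ → Prop
  | publicBudget _, b, b' => b' = b
  | privateBudget _, b, b' => b' ≤ b

/-- The quantity in which the size of the linear program is measured: `|Θ| |A| |Ω|` for a public
budget and `|Θ| |B| |A| |Ω|` for a private budget. -/
def dimension (Ω Θ A : Type*) [Fintype Ω] [Fintype Θ] [Fintype A] : BudgetSetting → ℕ
  | publicBudget _ => Fintype.card Θ * Fintype.card A * Fintype.card Ω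
  | privateBudget B => Fintype.card Θ * B.card * Fintype.card A * Fintype.card Ω

end BudgetSetting

/-- The two indicators: `plus` (the buyer gets nothing back) and `minus` (the buyer gets back his
deposit together with the seller's budget). -/
inductive Indicator where
  | plus
  | minus
  deriving DecidableEq

instance : Fintype Indicator where
  elems := {Indicator.plus, Indicator.minus}
  complete := by rintro (_ | _) <;> simp

/-- An information market: seller signals `Ω`, buyer signals `Θ`, buyer actions `A`, a common
prior `prior ω θ b` over seller signal, buyer signal and buyer budget (with arbitrary
correlation), the buyer's utility `u ω θ a`, and the seller's budget `M`. -/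
structure InfoMarket (Ω Θ A : Type*) [Fintype Ω] [Fintype Θ] (S : BudgetSetting) where
  prior : Ω → Θ → S.Budget → ℝ
  prior_nonneg : ∀ ω θ b, 0 ≤ prior ω θ b
  prior_sum : ∑ ω, ∑ θ, ∑ b, prior ω θ b = 1
  u : Ω → Θ → A → ℝ
  M : ℝ
  M_nonneg : 0 ≤ M

namespace InfoMarket

variable {Ω Θ A : Type*} [Fintype Ω] [Fintype Θ] [Fintype A] {S : BudgetSetting}

/-- The probability `μ(θ, b)` that the buyer has signal and budget `t = (θ, b)`. -/
def typeProb (G : InfoMarket Ω Θ A S) (t : Θ × S.Budget) : ℝ := ∑ ω, G.prior ω t.1 t.2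

/-- The belief `μ(ω | θ, b)` of the buyer `t = (θ, b)`; it is only meaningful (and is `0` by
convention otherwise) if `μ(θ, b) > 0`. -/
noncomputable def belief (G : InfoMarket Ω Θ A S) (t : Θ × S.Budget) (ω : Ω) : ℝ :=
  G.prior ω t.1 t.2 / G.typeProb t

/-- The net payment to the seller, when the budget `b` has been deposited and the indicator is
`i`: with `plus` nothing is returned, with `minus` the amount `b + M` is returned. -/
def payment (G : InfoMarket Ω Θ A S) (b : S.Budget) : Indicator → ℝ
  | .plus => b
  | .minus => b - (b + G.M)

/-- A recommendation policy: `p (θ, b) ω (a, i)` is the probability of the signal `[a, i]` if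
`(θ, b)` is reported and the seller's signal is `ω`. -/
abbrev Policy (Ω Θ A : Type*) (S : BudgetSetting) : Type _ :=
  Θ × S.Budget → Ω → A × Indicator → ℝ

/-- The probability of the signal `σ` in the eyes of the buyer `t` who reports `t'`. -/
noncomputable def signalProb (G : InfoMarket Ω Θ A S) (p : Policy Ω Θ A S)
    (t t' : Θ × S.Budget) (σ : A × Indicator) : ℝ :=
  ∑ ω, G.belief t ω * p t' ω σ

/-- The Bayesian posterior of the buyer `t` who has reported `t'` and received the signal `σ`
(meaningful if `σ` has positive probability). -/
noncomputable def posterior (G : InfoMarket Ω Θ A S) (p : Policy Ω Θ A S)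
    (t t' : Θ × S.Budget) (σ : A × Indicator) (ω : Ω) : ℝ :=
  G.belief t ω * p t' ω σ / G.signalProb p t t' σ

/-- The expected utility (payments included) of the buyer `t` who reports `t'` and then, after
each signal, takes an action that is optimal under his posterior. -/
noncomputable def utility [Nonempty A] (G : InfoMarket Ω Θ A S) (p : Policy Ω Θ A S)
    (t t' : Θ × S.Budget) : ℝ :=
  ∑ σ : A × Indicator, G.signalProb p t t' σ *
    (Finset.univ.sup' Finset.univ_nonempty
        (fun a' : A => ∑ ω, G.posterior p t t' σ ω * G.u ω t.1 a')
      - G.payment t'.2 σ.2)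

/-- The expected utility of the buyer `t` if he leaves at the beginning. -/
noncomputable def outsideOption [Nonempty A] (G : InfoMarket Ω Θ A S) (t : Θ × S.Budget) : ℝ :=
  Finset.univ.sup' Finset.univ_nonempty (fun a' : A => ∑ ω, G.belief t ω * G.u ω t.1 a')

/-- A consulting mechanism with probabilistic return: for each report and each seller signal a
distribution over `A × {+, -}`, such that, for each buyer that occurs with positive probability
and reports truthfully, each action recommended with positive probability is optimal under the
posterior (obedience). -/
structure CMProbR (G : InfoMarket Ω Θ A S) where
  policy : Policy Ω Θ A S
  nonneg : ∀ t ω σ, 0 ≤ policy t ω σ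
  sum_eq_one : ∀ t ω, ∑ σ, policy t ω σ = 1
  obedient : ∀ t, 0 < G.typeProb t → ∀ a i, 0 < G.signalProb policy t t (a, i) → ∀ a',
    ∑ ω, G.posterior policy t t (a, i) ω * G.u ω t.1 a' ≤
      ∑ ω, G.posterior policy t t (a, i) ω * G.u ω t.1 a

namespace CMProbR

variable {G : InfoMarket Ω Θ A S}

/-- Incentive compatibility: no buyer gains from a misreport that he is able to make. -/
def IsIC [Nonempty A] (m : CMProbR G) : Prop :=
  ∀ t t' : Θ × S.Budget, 0 < G.typeProb t → S.CanReport t.2 t'.2 →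
    G.utility m.policy t t' ≤ G.utility m.policy t t

/-- Individual rationality: no buyer gains from leaving at the beginning. -/
def IsIR [Nonempty A] (m : CMProbR G) : Prop :=
  ∀ t : Θ × S.Budget, 0 < G.typeProb t → G.outsideOption t ≤ G.utility m.policy t t

/-- The seller's expected revenue (from truthful buyers). -/
noncomputable def revenue (m : CMProbR G) : ℝ :=
  ∑ ω, ∑ θ, ∑ b, G.prior ω θ b *
    ∑ σ : A × Indicator, m.policy (θ, b) ω σ * G.payment b σ.2

/-- A revenue-maximal mechanism among the incentive compatible and individually rational
consulting mechanisms with probabilistic return. -/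
def IsOptimal [Nonempty A] (m : CMProbR G) : Prop :=
  m.IsIC ∧ m.IsIR ∧ ∀ m' : CMProbR G, m'.IsIC → m'.IsIR → m'.revenue ≤ m.revenue

end CMProbR

/-! ### The linear program -/

/-- The variables: `p t ω a i` is the probability of `[a, i]` at report `t` and seller signal `ω`;
`z t t' a i` stands for `max_{a'} ∑_ω μ(ω | t) p_{t'}(ω, [a, i]) (u(ω, θ, a') - payment)`. -/
inductive LPVar (Ω Θ A : Type*) (S : BudgetSetting) where
  | p (t : Θ × S.Budget) (ω : Ω) (a : A) (i : Indicator)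
  | z (t t' : Θ × S.Budget) (a : A) (i : Indicator)
  deriving Fintype

/-- The inequality constraints. -/
inductive LPIneq (Ω Θ A : Type*) (S : BudgetSetting) where
  | ic (t t' : Θ × S.Budget) (h : S.CanReport t.2 t'.2)
  | ir (t : Θ × S.Budget) (a' : A)
  | ob (t : Θ × S.Budget)
  | zMax (t t' : Θ × S.Budget) (a a' : A) (i : Indicator)
  | nonneg (t : Θ × S.Budget) (ω : Ω) (a : A) (i : Indicator)
  | leOne (t : Θ × S.Budget) (ω : Ω) (a : A) (i : Indicator)

/-- The equality constraints: one for each report and each seller signal. -/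
abbrev LPEq (Ω Θ : Type*) (S : BudgetSetting) : Type _ := (Θ × S.Budget) × Ω

open Classical in
noncomputable instance : Fintype (LPIneq Ω Θ A S) :=
  Fintype.ofSurjective
    (fun c : {q : (Θ × S.Budget) × (Θ × S.Budget) // S.CanReport q.1.2 q.2.2} ⊕
        ((Θ × S.Budget) × A) ⊕ (Θ × S.Budget) ⊕
        ((Θ × S.Budget) × (Θ × S.Budget) × A × A × Indicator) ⊕
        ((Θ × S.Budget) × Ω × A × Indicator) ⊕ ((Θ × S.Budget) × Ω × A × Indicator) =>
      match c with
      | .inl q => LPIneq.ic q.1.1 q.1.2 q.2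
      | .inr (.inl (t, a')) => LPIneq.ir t a'
      | .inr (.inr (.inl t)) => LPIneq.ob t
      | .inr (.inr (.inr (.inl (t, t', a, a', i)))) => LPIneq.zMax t t' a a' i
      | .inr (.inr (.inr (.inr (.inl (t, ω, a, i))))) => LPIneq.nonneg t ω a i
      | .inr (.inr (.inr (.inr (.inr (t, ω, a, i))))) => LPIneq.leOne t ω a i)
    (by
      rintro (⟨t, t', h⟩ | ⟨t, a'⟩ | t | ⟨t, t', a, a', i⟩ | ⟨t, ω, a, i⟩ | ⟨t, ω, a, i⟩)
      · exact ⟨.inl ⟨(t, t'), h⟩, rfl⟩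
      · exact ⟨.inr (.inl (t, a')), rfl⟩
      · exact ⟨.inr (.inr (.inl t)), rfl⟩
      · exact ⟨.inr (.inr (.inr (.inl (t, t', a, a', i)))), rfl⟩
      · exact ⟨.inr (.inr (.inr (.inr (.inl (t, ω, a, i))))), rfl⟩
      · exact ⟨.inr (.inr (.inr (.inr (.inr (t, ω, a, i))))), rfl⟩)

open Classical in
/-- The coefficient vector of the single variable `v`, with coefficient `r`. -/
noncomputable def coeff (v : LPVar Ω Θ A S) (r : ℝ) : LPVar Ω Θ A S → ℝ := Pi.single v r

/-- The linear form `U_t(t') = ∑_{a, i} z t t' a i`. -/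
noncomputable def utilityForm (t t' : Θ × S.Budget) : LPVar Ω Θ A S → ℝ :=
  ∑ a, ∑ i, coeff (.z t t' a i) 1

/-- The linear form `∑_ω μ(ω | t) p_{t'}(ω, [a, i]) (u(ω, θ, a') - payment)`. -/
noncomputable def actionForm (G : InfoMarket Ω Θ A S) (t t' : Θ × S.Budget) (a a' : A)
    (i : Indicator) : LPVar Ω Θ A S → ℝ :=
  ∑ ω, coeff (.p t' ω a i) (G.belief t ω * (G.u ω t.1 a' - G.payment t'.2 i))

/-- The linear program: maximize the revenue subject to
* (IC) `U_t(t') ≤ U_t(t)` whenever the buyer `t` is able to report `t'`;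
* (IR) `∑_ω μ(ω | t) u(ω, θ, a') ≤ U_t(t)`;
* (OB) `U_t(t) ≤ ∑_{a, i, ω} μ(ω | t) p_t(ω, [a, i]) (u(ω, θ, a) - payment)`;
* `∑_ω μ(ω | t) p_{t'}(ω, [a, i]) (u(ω, θ, a') - payment) ≤ z t t' a i`;
* `0 ≤ p_t(ω, [a, i]) ≤ 1` and `∑_{a, i} p_t(ω, [a, i]) = 1`. -/
noncomputable def lp (G : InfoMarket Ω Θ A S) :
    LinearProgram (LPVar Ω Θ A S) (LPIneq Ω Θ A S) (LPEq Ω Θ S) where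
  objective := ∑ ω, ∑ θ, ∑ b, ∑ a, ∑ i,
    coeff (.p (θ, b) ω a i) (G.prior ω θ b * G.payment b i)
  lhs
    | .ic t t' _ => utilityForm t t' - utilityForm t t
    | .ir t _ => -utilityForm t t
    | .ob t => utilityForm t t - ∑ a, ∑ i, G.actionForm t t a a i
    | .zMax t t' a a' i => G.actionForm t t' a a' i - coeff (.z t t' a i) 1
    | .nonneg t ω a i => -coeff (.p t ω a i) 1
    | .leOne t ω a i => coeff (.p t ω a i) 1
  rhs
    | .ic _ _ _ => 0
    | .ir t a' => -∑ ω, G.belief t ω * G.u ω t.1 a'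
    | .ob _ => 0
    | .zMax _ _ _ _ _ => 0
    | .nonneg _ _ _ _ => 0
    | .leOne _ _ _ _ => 1
  eqLhs e := ∑ a, ∑ i, coeff (.p e.1 e.2 a i) 1
  eqRhs _ := 1

/-- The policy that an assignment of the variables describes. -/
def policyOf (x : LPVar Ω Θ A S → ℝ) : Policy Ω Θ A S := fun t ω σ => x (.p t ω σ.1 σ.2)

/-- The assignment that a policy describes, with the `z`-variables equal to the maxima that they
stand for. -/
noncomputable def assignmentOf [Nonempty A] (G : InfoMarket Ω Θ A S) (p : Policy Ω Θ A S) :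
    LPVar Ω Θ A S → ℝ
  | .p t ω a i => p t ω (a, i)
  | .z t t' a i => Finset.univ.sup' Finset.univ_nonempty (fun a' : A =>
      ∑ ω, G.belief t ω * p t' ω (a, i) * (G.u ω t.1 a' - G.payment t'.2 i))

end InfoMarket

namespace InfoMarket

variable {Ω Θ A : Type*} [Fintype Ω] [Fintype Θ] {S : BudgetSetting}

/-! ### Beliefs -/

/-! The posterior after a signal has the signal's probability as denominator. Weighting each signal
by its probability cancels it, so the value of an action after a signal (`actionValue`) is linear in
the policy. Since this weight is nonnegative it commutes with the maximum over actions, and the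
utility of any report is a sum of maxima of linear forms (`utility_eq_sum_bestValue`).

The program only bounds the `z`-variables below by these maxima. For misreports this suffices,
because such `z` occur only on the smaller side of (IC). Truthful `z` also occur on the larger side
of (IC) and (IR), and there (OB) closes the gap: the values of the recommended actions are termwise
at most `z`, while (OB) bounds the sum of the `z` by the sum of these values. Hence equality holds
signal by signal, which makes each `z` the true maximum and makes the recommendation obedient
(`exists_mechanism_of_isFeasible`). Conversely, for an obedient mechanism the maxima satisfy (OB)
(`isFeasible_assignmentOf`).

The objective depends on the policy alone, so optima correspond in both directions. One exists by
compactness of the set of policies whose completion is feasible. -/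

theorem typeProb_nonneg (G : InfoMarket Ω Θ A S) (t : Θ × S.Budget) : 0 ≤ G.typeProb t :=
  Finset.sum_nonneg fun _ _ => G.prior_nonneg _ _ _

theorem belief_nonneg (G : InfoMarket Ω Θ A S) (t : Θ × S.Budget) (ω : Ω) : 0 ≤ G.belief t ω :=
  div_nonneg (G.prior_nonneg _ _ _) (G.typeProb_nonneg t)

/-- The program constrains all types, the mechanism only those of positive probability. Division by
zero gives the other types zero belief, which trivializes their constraints. -/
theorem belief_eq_zero (G : InfoMarket Ω Θ A S) {t : Θ × S.Budget} (ht : ¬ 0 < G.typeProb t)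
    (ω : Ω) : G.belief t ω = 0 := by
  rw [belief, le_antisymm (not_lt.1 ht) (G.typeProb_nonneg t), div_zero]

/-- The prior has total mass one. Nonemptiness matters for the size bounds: with no seller signal
the dimension would be zero although `z`-variables could remain. -/
theorem nonempty_signal_and_type (G : InfoMarket Ω Θ A S) :
    Nonempty Ω ∧ Nonempty (Θ × S.Budget) := by
  obtain ⟨ω, -, h⟩ := Finset.exists_ne_zero_of_sum_ne_zero (G.prior_sum.trans_ne one_ne_zero)
  obtain ⟨θ, -, h⟩ := Finset.exists_ne_zero_of_sum_ne_zero h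
  obtain ⟨b, -, -⟩ := Finset.exists_ne_zero_of_sum_ne_zero h
  exact ⟨⟨ω⟩, ⟨(θ, b)⟩⟩

/-! ### Unnormalized action values -/

/-- The contribution of the signal `σ` to the expected utility, payment included, of the buyer `t`
who has reported `t'` and takes the action `a'` after `σ`. -/
noncomputable def actionValue (G : InfoMarket Ω Θ A S) (p : Policy Ω Θ A S)
    (t t' : Θ × S.Budget) (σ : A × Indicator) (a' : A) : ℝ :=
  ∑ ω, G.belief t ω * p t' ω σ * (G.u ω t.1 a' - G.payment t'.2 σ.2)

theorem actionValue_eq_zero (G : InfoMarket Ω Θ A S) (p : Policy Ω Θ A S)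
    {t : Θ × S.Budget} (ht : ¬ 0 < G.typeProb t) (t' : Θ × S.Budget) (σ : A × Indicator) (a' : A) :
    G.actionValue p t t' σ a' = 0 := by
  simp [actionValue, G.belief_eq_zero ht]

theorem belief_mul_eq_zero (G : InfoMarket Ω Θ A S) {p : Policy Ω Θ A S}
    (hp : ∀ t ω σ, 0 ≤ p t ω σ) {t t' : Θ × S.Budget} {σ : A × Indicator}
    (h : G.signalProb p t t' σ = 0) (ω : Ω) : G.belief t ω * p t' ω σ = 0 :=
  (Finset.sum_eq_zero_iff_of_nonneg
    (fun ω _ => mul_nonneg (G.belief_nonneg t ω) (hp t' ω σ))).1 h ω (Finset.mem_univ ω)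

theorem signalProb_nonneg (G : InfoMarket Ω Θ A S) {p : Policy Ω Θ A S}
    (hp : ∀ t ω σ, 0 ≤ p t ω σ) (t t' : Θ × S.Budget) (σ : A × Indicator) :
    0 ≤ G.signalProb p t t' σ :=
  Finset.sum_nonneg fun ω _ => mul_nonneg (G.belief_nonneg t ω) (hp t' ω σ)

/-- The signal probability cancels the denominator of the posterior. If it vanishes, so does each
nonnegative summand, so the junk value of the posterior is harmless. -/
theorem actionValue_eq (G : InfoMarket Ω Θ A S) {p : Policy Ω Θ A S}
    (hp : ∀ t ω σ, 0 ≤ p t ω σ) (t t' : Θ × S.Budget) (σ : A × Indicator) (a' : A) :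
    G.actionValue p t t' σ a' = G.signalProb p t t' σ *
      (∑ ω, G.posterior p t t' σ ω * G.u ω t.1 a' - G.payment t'.2 σ.2) := by
  by_cases h : G.signalProb p t t' σ = 0
  · simp [actionValue, G.belief_mul_eq_zero hp h, h]
  · simp only [actionValue, mul_sub, Finset.sum_sub_distrib, ← Finset.sum_mul]
    congr 1
    rw [Finset.mul_sum]
    refine Finset.sum_congr rfl fun ω _ => ?_
    rw [posterior]
    field_simp

/-- The recommendation `σ.1` is optimal for the truthful buyer `t` whenever `σ` has positive
probability if and only if following it attains all unnormalized action values. -/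
theorem obedient_iff (G : InfoMarket Ω Θ A S) {p : Policy Ω Θ A S}
    (hp : ∀ t ω σ, 0 ≤ p t ω σ) (t : Θ × S.Budget) (σ : A × Indicator) :
    (0 < G.signalProb p t t σ → ∀ a', ∑ ω, G.posterior p t t σ ω * G.u ω t.1 a' ≤
      ∑ ω, G.posterior p t t σ ω * G.u ω t.1 σ.1) ↔
    ∀ a', G.actionValue p t t σ a' ≤ G.actionValue p t t σ σ.1 := by
  rcases (G.signalProb_nonneg hp t t σ).eq_or_lt with h | h
  -- After a null signal every action value is zero, so both sides hold.
  · simp [G.actionValue_eq hp, ← h]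
  · simp only [G.actionValue_eq hp, mul_le_mul_iff_right₀ h, h, sub_le_sub_iff_right, true_imp_iff]

variable [Fintype A]

section Nonempty

variable [Nonempty A]

/-- The contribution of the signal `σ` to the expected utility, payment included, of the buyer `t`
who has reported `t'` and best responds to `σ`. -/
noncomputable def bestValue (G : InfoMarket Ω Θ A S) (p : Policy Ω Θ A S)
    (t t' : Θ × S.Budget) (σ : A × Indicator) : ℝ :=
  Finset.univ.sup' Finset.univ_nonempty (G.actionValue p t t' σ)

theorem actionValue_le_bestValue (G : InfoMarket Ω Θ A S) (p : Policy Ω Θ A S)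
    (t t' : Θ × S.Budget) (σ : A × Indicator) (a' : A) :
    G.actionValue p t t' σ a' ≤ G.bestValue p t t' σ :=
  Finset.le_sup' (G.actionValue p t t' σ) (Finset.mem_univ a')

theorem bestValue_le (G : InfoMarket Ω Θ A S) (p : Policy Ω Θ A S)
    {t t' : Θ × S.Budget} {σ : A × Indicator} {c : ℝ}
    (h : ∀ a', G.actionValue p t t' σ a' ≤ c) : G.bestValue p t t' σ ≤ c :=
  Finset.sup'_le _ _ fun a' _ => h a'

theorem bestValue_eq_zero (G : InfoMarket Ω Θ A S) (p : Policy Ω Θ A S)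
    {t : Θ × S.Budget} (ht : ¬ 0 < G.typeProb t) (t' : Θ × S.Budget) (σ : A × Indicator) :
    G.bestValue p t t' σ = 0 := by
  obtain ⟨a⟩ := ‹Nonempty A›
  refine le_antisymm (G.bestValue_le p fun a' => (G.actionValue_eq_zero p ht t' σ a').le) ?_
  exact (G.actionValue_eq_zero p ht t' σ a).ge.trans (G.actionValue_le_bestValue p t t' σ a)

/-- Multiplication by a nonnegative number commutes with a finite maximum. -/
theorem bestValue_eq (G : InfoMarket Ω Θ A S) {p : Policy Ω Θ A S}
    (hp : ∀ t ω σ, 0 ≤ p t ω σ) (t t' : Θ × S.Budget) (σ : A × Indicator) :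
    G.bestValue p t t' σ = G.signalProb p t t' σ *
      (Finset.univ.sup' Finset.univ_nonempty
        (fun a' : A => ∑ ω, G.posterior p t t' σ ω * G.u ω t.1 a') - G.payment t'.2 σ.2) := by
  apply le_antisymm
  · refine G.bestValue_le p fun a' => ?_
    rw [G.actionValue_eq hp]
    refine mul_le_mul_of_nonneg_left (sub_le_sub_right ?_ _) (G.signalProb_nonneg hp _ _ _)
    exact Finset.le_sup' (fun a' : A => ∑ ω, G.posterior p t t' σ ω * G.u ω t.1 a')
      (Finset.mem_univ a')
  · obtain ⟨a', -, h⟩ := Finset.exists_mem_eq_sup' Finset.univ_nonempty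
      (fun a' : A => ∑ ω, G.posterior p t t' σ ω * G.u ω t.1 a')
    rw [h, ← G.actionValue_eq hp]
    exact G.actionValue_le_bestValue p t t' σ a'

theorem utility_eq_sum_bestValue (G : InfoMarket Ω Θ A S) {p : Policy Ω Θ A S}
    (hp : ∀ t ω σ, 0 ≤ p t ω σ) (t t' : Θ × S.Budget) :
    G.utility p t t' = ∑ σ, G.bestValue p t t' σ :=
  Finset.sum_congr rfl fun σ _ => (G.bestValue_eq hp t t' σ).symm

theorem le_outsideOption (G : InfoMarket Ω Θ A S) (t : Θ × S.Budget) (a : A) :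
    ∑ ω, G.belief t ω * G.u ω t.1 a ≤ G.outsideOption t :=
  Finset.le_sup' (fun a' : A => ∑ ω, G.belief t ω * G.u ω t.1 a') (Finset.mem_univ a)

end Nonempty

/-! ### The constraints of the program -/

theorem coeff_dotProduct (v : LPVar Ω Θ A S) (r : ℝ) (x : LPVar Ω Θ A S → ℝ) :
    coeff v r ⬝ᵥ x = r * x v := by
  classical
  unfold coeff
  convert single_dotProduct x r v

theorem utilityForm_dotProduct (t t' : Θ × S.Budget) (x : LPVar Ω Θ A S → ℝ) :
    utilityForm t t' ⬝ᵥ x = ∑ σ : A × Indicator, x (.z t t' σ.1 σ.2) := by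
  simp [utilityForm, sum_dotProduct, coeff_dotProduct, Fintype.sum_prod_type]

theorem actionForm_dotProduct (G : InfoMarket Ω Θ A S) (t t' : Θ × S.Budget) (a a' : A)
    (i : Indicator) (x : LPVar Ω Θ A S → ℝ) :
    G.actionForm t t' a a' i ⬝ᵥ x = G.actionValue (policyOf x) t t' (a, i) a' := by
  simp only [actionForm, sum_dotProduct, coeff_dotProduct, actionValue, policyOf]
  exact Finset.sum_congr rfl fun ω _ => by ring

theorem value_lp (G : InfoMarket Ω Θ A S) (x : LPVar Ω Θ A S → ℝ) :
    G.lp.value x = ∑ ω, ∑ θ, ∑ b, G.prior ω θ b *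
      ∑ σ : A × Indicator, policyOf x (θ, b) ω σ * G.payment b σ.2 := by
  simp only [LinearProgram.value, lp, sum_dotProduct, coeff_dotProduct, policyOf,
    Fintype.sum_prod_type, Finset.mul_sum]
  refine Finset.sum_congr rfl fun ω _ => Finset.sum_congr rfl fun θ _ =>
    Finset.sum_congr rfl fun b _ => Finset.sum_congr rfl fun a _ =>
    Finset.sum_congr rfl fun i _ => by ring

/-- The constraints of the linear program, written out. -/
theorem isFeasible_lp_iff (G : InfoMarket Ω Θ A S) (x : LPVar Ω Θ A S → ℝ) :
    G.lp.IsFeasible x ↔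
      (∀ t t' : Θ × S.Budget, S.CanReport t.2 t'.2 →
        ∑ σ : A × Indicator, x (.z t t' σ.1 σ.2) ≤ ∑ σ : A × Indicator, x (.z t t σ.1 σ.2)) ∧
      (∀ t a', ∑ ω, G.belief t ω * G.u ω t.1 a' ≤ ∑ σ : A × Indicator, x (.z t t σ.1 σ.2)) ∧
      (∀ t, ∑ σ : A × Indicator, x (.z t t σ.1 σ.2) ≤
        ∑ σ : A × Indicator, G.actionValue (policyOf x) t t σ σ.1) ∧
      (∀ t t' σ a', G.actionValue (policyOf x) t t' σ a' ≤ x (.z t t' σ.1 σ.2)) ∧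
      (∀ t ω σ, 0 ≤ policyOf x t ω σ) ∧ (∀ t ω σ, policyOf x t ω σ ≤ 1) ∧
      ∀ t ω, ∑ σ, policyOf x t ω σ = 1 := by
  constructor
  · rintro ⟨hi, he⟩
    refine ⟨fun t t' h => ?_, fun t a' => ?_, fun t => ?_, fun t t' σ a' => ?_, fun t ω σ => ?_,
      fun t ω σ => ?_, fun t ω => ?_⟩
    · simpa [lp, sub_dotProduct, utilityForm_dotProduct] using hi (.ic t t' h)
    · simpa [lp, neg_dotProduct, utilityForm_dotProduct] using hi (.ir t a')
    · simpa [lp, sub_dotProduct, sum_dotProduct, utilityForm_dotProduct, actionForm_dotProduct,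
        Fintype.sum_prod_type] using hi (.ob t)
    · simpa [lp, sub_dotProduct, coeff_dotProduct, actionForm_dotProduct]
        using hi (.zMax t t' σ.1 a' σ.2)
    · simpa [lp, neg_dotProduct, coeff_dotProduct, policyOf] using hi (.nonneg t ω σ.1 σ.2)
    · simpa [lp, coeff_dotProduct, policyOf] using hi (.leOne t ω σ.1 σ.2)
    · simpa [lp, sum_dotProduct, coeff_dotProduct, policyOf, Fintype.sum_prod_type]
        using he (t, ω)
  · rintro ⟨hic, hir, hob, hz, h0, h1, hs⟩
    refine ⟨?_, fun e => ?_⟩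
    · rintro (⟨t, t', h⟩ | ⟨t, a'⟩ | t | ⟨t, t', a, a', i⟩ | ⟨t, ω, a, i⟩ | ⟨t, ω, a, i⟩)
      · simpa [lp, sub_dotProduct, utilityForm_dotProduct] using hic t t' h
      · simpa [lp, neg_dotProduct, utilityForm_dotProduct] using hir t a'
      · simpa [lp, sub_dotProduct, sum_dotProduct, utilityForm_dotProduct, actionForm_dotProduct,
          Fintype.sum_prod_type] using hob t
      · simpa [lp, sub_dotProduct, coeff_dotProduct, actionForm_dotProduct]
          using hz t t' (a, i) a'
      · simpa [lp, neg_dotProduct, coeff_dotProduct, policyOf] using h0 t ω (a, i)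
      · simpa [lp, coeff_dotProduct, policyOf] using h1 t ω (a, i)
    · simpa [lp, sum_dotProduct, coeff_dotProduct, policyOf, Fintype.sum_prod_type]
        using hs e.1 e.2

theorem isClosed_setOf_isFeasible (G : InfoMarket Ω Θ A S) :
    IsClosed {x | G.lp.IsFeasible x} := by
  simp only [LinearProgram.IsFeasible, Set.ofPred_and, Set.ofPred_forall, dotProduct]
  refine (isClosed_iInter fun c => isClosed_le ?_ ?_).inter
    (isClosed_iInter fun e => isClosed_eq ?_ ?_) <;> fun_prop

/-! ### Mechanisms and feasible solutions -/

section Nonempty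

variable [Nonempty A]

theorem policyOf_assignmentOf (G : InfoMarket Ω Θ A S) (p : Policy Ω Θ A S) :
    policyOf (G.assignmentOf p) = p := rfl

theorem assignmentOf_z (G : InfoMarket Ω Θ A S) (p : Policy Ω Θ A S) (t t' : Θ × S.Budget)
    (a : A) (i : Indicator) : G.assignmentOf p (.z t t' a i) = G.bestValue p t t' (a, i) := rfl

/-- The constraint (OB) forces equality in the `zMax` constraints of truthful reports at the
recommended actions; misreports need only the upper bound `hbz`. -/
theorem exists_mechanism_of_isFeasible (G : InfoMarket Ω Θ A S) {x : LPVar Ω Θ A S → ℝ}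
    (hx : G.lp.IsFeasible x) :
    ∃ m : G.CMProbR, m.policy = policyOf x ∧ m.IsIC ∧ m.IsIR ∧ m.revenue = G.lp.value x := by
  obtain ⟨hic, hir, hob, hz, h0, h1, hs⟩ := (G.isFeasible_lp_iff x).1 hx
  have hbz : ∀ t t' σ, G.bestValue (policyOf x) t t' σ ≤ x (.z t t' σ.1 σ.2) := fun t t' σ =>
    G.bestValue_le _ (hz t t' σ)
  have heq : ∀ t σ, G.actionValue (policyOf x) t t σ σ.1 = x (.z t t σ.1 σ.2) := by
    intro t σ
    -- Termwise inequalities whose sums agree are termwise equalities.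
    have h := (Finset.sum_eq_sum_iff_of_le (s := Finset.univ)
      (fun σ _ => hz t t σ σ.1)).1
      (le_antisymm (Finset.sum_le_sum fun σ _ => hz t t σ σ.1) (hob t))
    exact h σ (Finset.mem_univ σ)
  have hu : ∀ t, G.utility (policyOf x) t t = ∑ σ : A × Indicator, x (.z t t σ.1 σ.2) := by
    intro t
    rw [G.utility_eq_sum_bestValue h0]
    exact Finset.sum_congr rfl fun σ _ => le_antisymm (hbz t t σ)
      ((heq t σ).ge.trans (G.actionValue_le_bestValue _ t t σ σ.1))
  refine ⟨⟨policyOf x, h0, hs, fun t _ a i => (G.obedient_iff h0 t (a, i)).2 fun a' => ?_⟩,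
    rfl, fun t t' _ h => ?_, fun t _ => ?_, (G.value_lp x).symm⟩
  · exact (hz t t (a, i) a').trans (heq t (a, i)).ge
  · change G.utility (policyOf x) t t' ≤ G.utility (policyOf x) t t
    rw [hu, G.utility_eq_sum_bestValue h0]
    exact (Finset.sum_le_sum fun σ _ => hbz t t' σ).trans (hic t t' h)
  · change _ ≤ G.utility (policyOf x) t t
    rw [hu]
    exact Finset.sup'_le _ _ fun a' _ => hir t a'

theorem isFeasible_assignmentOf {G : InfoMarket Ω Θ A S} (m : G.CMProbR) (hic : m.IsIC)
    (hir : m.IsIR) : G.lp.IsFeasible (G.assignmentOf m.policy) := by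
  have hu := G.utility_eq_sum_bestValue m.nonneg
  rw [isFeasible_lp_iff]
  simp only [policyOf_assignmentOf, assignmentOf_z]
  refine ⟨fun t t' h => ?_, fun t a' => ?_, fun t => ?_,
    fun t t' σ a' => G.actionValue_le_bestValue _ t t' σ a', m.nonneg, fun t ω σ => ?_,
    m.sum_eq_one⟩
  -- For a null type both sides are zero, here and in the next two constraints.
  · by_cases ht : 0 < G.typeProb t
    · simpa only [hu] using hic t t' ht h
    · simp [G.bestValue_eq_zero _ ht]
  · by_cases ht : 0 < G.typeProb t
    · simpa only [hu] using (G.le_outsideOption t a').trans (hir t ht)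
    · simp [G.bestValue_eq_zero _ ht, G.belief_eq_zero ht]
  · by_cases ht : 0 < G.typeProb t
    · exact Finset.sum_le_sum fun σ _ => G.bestValue_le _
        ((G.obedient_iff m.nonneg t σ).1 (m.obedient t ht σ.1 σ.2))
    · simp [G.bestValue_eq_zero _ ht, G.actionValue_eq_zero _ ht]
  · exact (Finset.single_le_sum (fun σ _ => m.nonneg t ω σ) (Finset.mem_univ σ)).trans_eq
      (m.sum_eq_one t ω)

theorem value_assignmentOf {G : InfoMarket Ω Θ A S} (m : G.CMProbR) :
    G.lp.value (G.assignmentOf m.policy) = m.revenue :=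
  G.value_lp _

theorem isOptimal_of_isFeasible_of_revenue_eq {G : InfoMarket Ω Θ A S} {x : LPVar Ω Θ A S → ℝ}
    (hx : G.lp.IsOptimal x) {m : G.CMProbR} (hic : m.IsIC) (hir : m.IsIR)
    (hm : m.revenue = G.lp.value x) : m.IsOptimal := by
  refine ⟨hic, hir, fun m' hic' hir' => ?_⟩
  rw [hm, ← value_assignmentOf]
  exact hx.2 _ (isFeasible_assignmentOf m' hic' hir')

theorem isOptimal_assignmentOf {G : InfoMarket Ω Θ A S} {m : G.CMProbR} (hm : m.IsOptimal) :
    G.lp.IsOptimal (G.assignmentOf m.policy) := by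
  refine ⟨isFeasible_assignmentOf m hm.1 hm.2.1, fun y hy => ?_⟩
  obtain ⟨m', -, hic, hir, h⟩ := G.exists_mechanism_of_isFeasible hy
  rw [value_assignmentOf, ← h]
  exact hm.2.2 m' hic hir

/-! ### Existence of an optimal solution -/

/-- Recommending, without any information, an optimal action under the prior belief of the reported
type and always returning the budgets is a feasible solution. -/
theorem exists_isFeasible (G : InfoMarket Ω Θ A S) : ∃ x, G.lp.IsFeasible x := by
  classical
  have hbest (t : Θ × S.Budget) :
      ∃ a : A, G.outsideOption t = ∑ ω, G.belief t ω * G.u ω t.1 a := by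
    obtain ⟨a, -, h⟩ := Finset.exists_mem_eq_sup' Finset.univ_nonempty
      (fun a' : A => ∑ ω, G.belief t ω * G.u ω t.1 a')
    exact ⟨a, h⟩
  choose best hbest using hbest
  let p : Policy Ω Θ A S := fun t _ σ => if σ = (best t, .minus) then 1 else 0
  -- The policy always pays out `G.M` and reveals nothing, so every report is worth the same to `t`
  -- and (IC) is tight. The belief mass is kept as a factor because it is zero for null types.
  let v : Θ × S.Budget → ℝ := fun t => G.outsideOption t + G.M * ∑ ω, G.belief t ω
  let x : LPVar Ω Θ A S → ℝ := fun
    | .p t ω a i => p t ω (a, i)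
    | .z t t' a i => if (a, i) = (best t', Indicator.minus) then v t else 0
  have hval (t t' : Θ × S.Budget) (σ : A × Indicator) (a' : A) :
      G.actionValue p t t' σ a' = if σ = (best t', Indicator.minus) then
        ∑ ω, G.belief t ω * G.u ω t.1 a' + G.M * ∑ ω, G.belief t ω else 0 := by
    simp only [actionValue, p]
    split_ifs with h
    · simp only [h, payment, Finset.mul_sum, ← Finset.sum_add_distrib]
      exact Finset.sum_congr rfl fun ω _ => by ring
    · simp
  have hsum (t t' : Θ × S.Budget) :
      ∑ σ : A × Indicator, (if σ = (best t', Indicator.minus) then v t else 0) = v t := by simp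
  refine ⟨x, (G.isFeasible_lp_iff x).2 ⟨fun t t' _ => ?_, fun t a' => ?_, fun t => ?_,
    fun t t' σ a' => ?_, fun t ω σ => ?_, fun t ω σ => ?_, fun t ω => ?_⟩⟩
  · exact ((hsum t t').trans (hsum t t).symm).le
  · refine le_trans ?_ (hsum t t).ge
    exact (G.le_outsideOption t a').trans (le_add_of_nonneg_right
      (mul_nonneg G.M_nonneg (Finset.sum_nonneg fun ω _ => G.belief_nonneg t ω)))
  · refine Finset.sum_le_sum fun σ _ => ?_
    change (if σ = (best t, Indicator.minus) then v t else 0) ≤ G.actionValue p t t σ σ.1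
    rw [hval]
    split_ifs with h
    · simp only [v, hbest, h, le_refl]
    · exact le_rfl
  · change G.actionValue p t t' σ a' ≤ if σ = (best t', Indicator.minus) then v t else 0
    rw [hval]
    split_ifs with h
    · exact add_le_add_left (G.le_outsideOption t a') _
    · exact le_rfl
  · change 0 ≤ p t ω σ
    simp only [p]
    split_ifs <;> norm_num
  · change p t ω σ ≤ 1
    simp only [p]
    split_ifs <;> norm_num
  · change ∑ σ, p t ω σ = 1
    simp [p]

theorem continuous_assignmentOf (G : InfoMarket Ω Θ A S) : Continuous G.assignmentOf := by
  refine continuous_pi fun v => ?_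
  cases v with
  | p t ω a i => exact (continuous_apply_apply ω (a, i)).comp (continuous_apply t)
  | z t t' a i =>
    simp only [assignmentOf]
    refine Continuous.finset_sup'_apply _ fun a' _ => ?_
    fun_prop

theorem exists_isOptimal (G : InfoMarket Ω Θ A S) : ∃ x, G.lp.IsOptimal x := by
  -- The feasible set itself may be unbounded: `z t t'` has no upper bound when `t` cannot report
  -- `t'`. Maximization therefore runs over policies, which lie in a cube, with canonical `z`.
  let K : Set (Policy Ω Θ A S) := {p | G.lp.IsFeasible (G.assignmentOf p)}
  have hK : IsCompact K := by
    refine (isCompact_Icc (a := (0 : Policy Ω Θ A S)) (b := 1)).of_isClosed_subset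
      (G.isClosed_setOf_isFeasible.preimage G.continuous_assignmentOf) fun p hp => ?_
    obtain ⟨-, -, -, -, h0, h1, -⟩ := (G.isFeasible_lp_iff _).1 hp
    exact ⟨fun t ω σ => h0 t ω σ, fun t ω σ => h1 t ω σ⟩
  -- Replacing the `z`-part by the true maxima preserves feasibility and value, so a maximum over
  -- `K` is a maximum of the program.
  have hmem : ∀ y, G.lp.IsFeasible y →
      policyOf y ∈ K ∧ G.lp.value (G.assignmentOf (policyOf y)) = G.lp.value y := by
    intro y hy
    obtain ⟨m, hm, hic, hir, h⟩ := G.exists_mechanism_of_isFeasible hy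
    rw [← hm, ← h]
    exact ⟨isFeasible_assignmentOf m hic hir, value_assignmentOf m⟩
  have hcont : Continuous fun p => G.lp.value (G.assignmentOf p) := by
    have := G.continuous_assignmentOf
    simp only [LinearProgram.value, dotProduct]
    fun_prop
  obtain ⟨y, hy⟩ := G.exists_isFeasible
  obtain ⟨p, hp, hmax⟩ := hK.exists_isMaxOn ⟨_, (hmem y hy).1⟩ hcont.continuousOn
  refine ⟨G.assignmentOf p, hp, fun y hy => ?_⟩
  rw [← (hmem y hy).2]
  exact hmax (hmem y hy).1

end Nonempty

/-! ### The size of the program -/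

theorem card_indicator : Fintype.card Indicator = 2 := rfl

/-- A public budget is a one-element budget set, so both settings are counted alike. -/
theorem dimension_eq (S : BudgetSetting) :
    S.dimension Ω Θ A = Fintype.card (Θ × S.Budget) * Fintype.card A * Fintype.card Ω := by
  rw [Fintype.card_prod, Fintype.card_coe]
  cases S <;> simp [BudgetSetting.dimension, BudgetSetting.budgets]

theorem numVariables_lp (G : InfoMarket Ω Θ A S) :
    G.lp.numVariables = 2 * (Fintype.card (Θ × S.Budget) * Fintype.card Ω * Fintype.card A) +
      2 * (Fintype.card (Θ × S.Budget) ^ 2 * Fintype.card A) := by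
  let e : LPVar Ω Θ A S ≃ ((Θ × S.Budget) × Ω × A × Indicator) ⊕
      ((Θ × S.Budget) × (Θ × S.Budget) × A × Indicator) :=
    { toFun := fun
        | .p t ω a i => .inl (t, ω, a, i)
        | .z t t' a i => .inr (t, t', a, i)
      invFun := Sum.elim (fun q => .p q.1 q.2.1 q.2.2.1 q.2.2.2)
        (fun q => .z q.1 q.2.1 q.2.2.1 q.2.2.2)
      left_inv := by rintro (_ | _) <;> rfl
      right_inv := by rintro (_ | _) <;> rfl }
  rw [LinearProgram.numVariables, Fintype.card_congr e, Fintype.card_sum]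
  simp only [Fintype.card_prod (Θ × S.Budget), Fintype.card_prod Ω, Fintype.card_prod A,
    card_indicator]
  ring

theorem card_lpIneq_le : Fintype.card (LPIneq Ω Θ A S) ≤
    Fintype.card (Θ × S.Budget) ^ 2 + Fintype.card (Θ × S.Budget) * Fintype.card A +
      Fintype.card (Θ × S.Budget) +
      2 * (Fintype.card (Θ × S.Budget) ^ 2 * Fintype.card A ^ 2) +
      4 * (Fintype.card (Θ × S.Budget) * Fintype.card Ω * Fintype.card A) := by
  let f : LPIneq Ω Θ A S → ((Θ × S.Budget) × (Θ × S.Budget)) ⊕ ((Θ × S.Budget) × A) ⊕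
      (Θ × S.Budget) ⊕ ((Θ × S.Budget) × (Θ × S.Budget) × A × A × Indicator) ⊕
      ((Θ × S.Budget) × Ω × A × Indicator) ⊕ ((Θ × S.Budget) × Ω × A × Indicator) := fun
    | .ic t t' _ => .inl (t, t')
    | .ir t a' => .inr (.inl (t, a'))
    | .ob t => .inr (.inr (.inl t))
    | .zMax t t' a a' i => .inr (.inr (.inr (.inl (t, t', a, a', i))))
    | .nonneg t ω a i => .inr (.inr (.inr (.inr (.inl (t, ω, a, i)))))
    | .leOne t ω a i => .inr (.inr (.inr (.inr (.inr (t, ω, a, i)))))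
  -- Only an upper bound results, since (IC) is indexed by the reportable pairs alone.
  have hf : Function.Injective f := by
    rintro (_ | _ | _ | _ | _ | _) (_ | _ | _ | _ | _ | _) h <;> simp_all [f]
  refine (Fintype.card_le_of_injective f hf).trans_eq ?_
  simp only [Fintype.card_sum, Fintype.card_prod (Θ × S.Budget), Fintype.card_prod Ω,
    Fintype.card_prod A, card_indicator]
  ring

theorem numVariables_lp_le [Nonempty A] (G : InfoMarket Ω Θ A S) :
    G.lp.numVariables ≤ 4 * S.dimension Ω Θ A ^ 2 := by
  obtain ⟨_, _⟩ := G.nonempty_signal_and_type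
  rw [numVariables_lp, dimension_eq]
  have hT := Fintype.card_pos (α := Θ × S.Budget)
  have hA := Fintype.card_pos (α := A)
  have hW := Fintype.card_pos (α := Ω)
  generalize Fintype.card (Θ × S.Budget) = T at *
  generalize Fintype.card A = a at *
  generalize Fintype.card Ω = w at *
  have h1 : T * w * a ≤ (T * a * w) ^ 2 :=
    (mul_right_comm T w a).trans_le (Nat.le_self_pow two_ne_zero _)
  have h2 : T ^ 2 * a ≤ (T * a * w) ^ 2 :=
    calc T ^ 2 * a = T ^ 2 * a * 1 := by ring
      _ ≤ T ^ 2 * a ^ 2 * w ^ 2 := by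
        gcongr
        · exact Nat.le_self_pow two_ne_zero _
        · exact Nat.one_le_pow _ _ hW
      _ = _ := by ring
  omega

theorem numConstraints_lp_le [Nonempty A] (G : InfoMarket Ω Θ A S) :
    G.lp.numConstraints ≤ 10 * S.dimension Ω Θ A ^ 2 := by
  obtain ⟨_, _⟩ := G.nonempty_signal_and_type
  have hcard := card_lpIneq_le (Ω := Ω) (Θ := Θ) (A := A) (S := S)
  rw [LinearProgram.numConstraints, Fintype.card_prod (Θ × S.Budget) Ω, dimension_eq]
  have hT := Fintype.card_pos (α := Θ × S.Budget)
  have hA := Fintype.card_pos (α := A)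
  have hW := Fintype.card_pos (α := Ω)
  generalize Fintype.card (Θ × S.Budget) = T at *
  generalize Fintype.card A = a at *
  generalize Fintype.card Ω = w at *
  -- All cardinalities are at least one, so each monomial with exponents at most two is bounded by
  -- the square of the dimension. The coefficients 1, 1, 1, 2, 4 of the inequalities and 1 of the
  -- equalities add up to 10.
  have hle {i j k : ℕ} (hi : i ≤ 2) (hj : j ≤ 2) (hk : k ≤ 2) :
      T ^ i * a ^ j * w ^ k ≤ (T * a * w) ^ 2 := by
    rw [mul_pow, mul_pow]
    gcongr
  have h1 := hle (i := 2) (j := 0) (k := 0) (by simp) (by simp) (by simp)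
  have h2 := hle (i := 1) (j := 1) (k := 0) (by simp) (by simp) (by simp)
  have h3 := hle (i := 1) (j := 0) (k := 0) (by simp) (by simp) (by simp)
  have h4 := hle (i := 2) (j := 2) (k := 0) (by simp) (by simp) (by simp)
  have h5 := hle (i := 1) (j := 1) (k := 1) (by simp) (by simp) (by simp)
  have h6 := hle (i := 1) (j := 0) (k := 1) (by simp) (by simp) (by simp)
  simp only [pow_zero, pow_one, mul_one] at h1 h2 h3 h4 h5 h6
  replace h5 := (mul_right_comm T w a).trans_le h5
  omega

end InfoMarket

theorem mainTheorem4 {Ω Θ A : Type*} [Fintype Ω] [Fintype Θ] [Fintype A] [Nonempty A]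
    (S : BudgetSetting) (G : InfoMarket Ω Θ A S) :
    -- the program has polynomial size
    (G.lp.numVariables ≤ 4 * S.dimension Ω Θ A ^ 2 ∧
      G.lp.numConstraints ≤ 10 * S.dimension Ω Θ A ^ 2) ∧
    -- feasible solutions are IC and IR mechanisms, and the objective is the revenue
    (∀ x, G.lp.IsFeasible x → ∃ m : G.CMProbR,
      m.policy = InfoMarket.policyOf x ∧ m.IsIC ∧ m.IsIR ∧ m.revenue = G.lp.value x) ∧
    -- every IC and IR mechanism arises, with the `z`-variables equal to the maxima
    (∀ m : G.CMProbR, m.IsIC → m.IsIR →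
      G.lp.IsFeasible (G.assignmentOf m.policy) ∧
        G.lp.value (G.assignmentOf m.policy) = m.revenue) ∧
    -- the program has an optimal solution
    (∃ x, G.lp.IsOptimal x) ∧
    -- its optimal solutions are exactly the optimal mechanisms
    (∀ x, G.lp.IsOptimal x → ∃ m : G.CMProbR,
      m.policy = InfoMarket.policyOf x ∧ m.IsOptimal ∧ m.revenue = G.lp.value x) ∧
    (∀ m : G.CMProbR, m.IsOptimal → G.lp.IsOptimal (G.assignmentOf m.policy)) := by
  refine ⟨⟨G.numVariables_lp_le, G.numConstraints_lp_le⟩,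
    fun x hx => G.exists_mechanism_of_isFeasible hx,
    fun m hic hir => ⟨InfoMarket.isFeasible_assignmentOf m hic hir,
      InfoMarket.value_assignmentOf m⟩,
    G.exists_isOptimal, fun x hx => ?_, fun m hm => InfoMarket.isOptimal_assignmentOf hm⟩
  obtain ⟨m, hm, hic, hir, h⟩ := G.exists_mechanism_of_isFeasible hx.1
  exact ⟨m, hm, InfoMarket.isOptimal_of_isFeasible_of_revenue_eq hx hic hir h, h⟩
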